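/- Let $\mathcal P_n=\{(p_1,\dots,p_n)\in\mathbb R^n : p_1\ge\dots\ge p_n\ge 0,\ \sum_i p_i=1\}$. For $\mathbf p,\mathbf q\in\mathcal P_n$ let $\mathcal C(\mathbf p,\mathbf q)$ be the set of couplings of $\mathbf p$ and $\mathbf q$, i.e. of matrices $\mathbf M=[m_{ij}]\in\mathbb R^{n\times n}$ with $m_{ij}\ge 0$, $\sum_j m_{ij}=p_i$ for all $i$ and $\sum_i m_{ij}=q_j$ for all $j$. Let $\mathbf z=\mathbf p\wedge\mathbf q$ be the greatest lower bound of $\mathbf p,\mathbf q$ with respect to majorization, that is, $z_i=\min\{\sum_{j\le i}p_j,\sum_{j\le i}q_j\}-\sum_{j<i}z_j$. Inversion points. Assume that $p_i>q_i$ for the maximum $i$ with $p_i\ne q_i$, if there is one. Put $i_0=n+1$. As long as $i_{s-1}\neq 1$, let $i_s$ be the minimum index $i_s<i_{s-1}$ such that for all $i=i_s,\dots,i_{s-1}-1$ one has $\sum_{l=i}^n p_l\ge\sum_{l=i}^n q_l$ if $s$ is odd, and $\sum_{l=i}^n p_l\le\sum_{l=i}^n q_l$ if $s$ is even. Let $k$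 be the first index with $i_k=1$. Splitting procedure. $\mathrm{Split}(z,x,A[a\dots b])$: start with $l=a$, $Q=\emptyset$, $\sigma=0$; while $l\le b$ and $\sigma+A[l]<x$, add $l$ to $Q$, add $A[l]$ to $\sigma$, and increase $l$ by $1$; return $z^{(d)}=x-\sigma$, $z^{(r)}=z-z^{(d)}$ and $Q$. Algorithm (Min-Entropy-Joint-Distribution), on input $\mathbf p,\mathbf q\in\mathcal P_n$. 1. Set all $m_{ij}$, $R[i]$, $C[i]$ to $0$. If $\mathbf p\ne\mathbf q$ and $p_i<q_i$ for $i=\max\{j: p_j\neq q_j\}$, swap $\mathbf p$ and $\mathbf q$. Compute the inversion points $i_0>\dots>i_k$ and $\mathbf z=\mathbf p\wedge\mathbf q$. 2. For $s=1,\dots,k$: (a) if $s$ is odd: for $j=i_{s-1}-1$ down to $i_s$, let $(z_j^{(d)},z_j^{(r)},Q)=\mathrm{Split}(z_j,q_j,R[j+1\dots i_{s-1}-1])$; for each $\ell\in Q$ set $m_{\ell j}\leftarrow R[\ell]$, then $R[\ell]\leftarrow 0$; set $m_{jj}\leftarrow z_j^{(d)}$, $R[j]\leftarrow z_j^{(r)}$.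 After this loop, if $i_s\ne1$, for each $\ell\in\{i_s,\dots,i_{s-1}-1\}$ with $R[\ell]\ne0$ set $m_{\ell,\,i_s-1}\leftarrow R[\ell]$, then $R[\ell]\leftarrow0$; (b) if $s$ is even: for $j=i_{s-1}-1$ down to $i_s$, let $(z_j^{(d)},z_j^{(r)},Q)=\mathrm{Split}(z_j,p_j,C[j+1\dots i_{s-1}-1])$; for each $\ell\in Q$ set $m_{j\ell}\leftarrow C[\ell]$, then $C[\ell]\leftarrow 0$; set $m_{jj}\leftarrow z_j^{(d)}$, $C[j]\leftarrow z_j^{(r)}$. After this loop, if $i_s\ne1$, for each $\ell\in\{i_s,\dots,i_{s-1}-1\}$ with $C[\ell]\ne0$ set $m_{i_s-1,\,\ell}\leftarrow C[\ell]$, then $C[\ell]\leftarrow0$. 3. Output $\mathbf M=[m_{ij}]$, or its transpose if $\mathbf p$ and $\mathbf q$ were swapped in step 1. Theorem. For any $\mathbf p,\mathbf q\in\mathcal P_n$, the matrix $\mathbf M=[m_{ij}]$ output by this algorithm belongs to $\mathcal C(\mathbf p,\mathbf q)$: its entries are nonnegative, $\sum_j m_{ij}=p_i$ for all $i$, and $\sum_i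 m_{ij}=q_j$ for all $j$. -/

import Mathlib

namespace MinEntropyCoupling

noncomputable section

/-- A real matrix and two real arrays: the variables `m`, `R`, `C` of the algorithm.
Only the positions `1, …, n` are used. -/
structure State where
  M : ℕ → ℕ → ℝ
  R : ℕ → ℝ
  C : ℕ → ℝ

/-- The set `𝒫ₙ` of ordered probability vectors `p₁ ≥ … ≥ pₙ ≥ 0` with `∑ pᵢ = 1`. -/
def orderedProb (n : ℕ) : Set (Fin n → ℝ) :=
  {p | Antitone p ∧ (∀ i, 0 ≤ p i) ∧ ∑ i, p i = 1}

/-- The set `𝒞(p, q)` of couplings (joint distributions with marginals `p` and `q`): matrices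
with nonnegative entries, row sums `pᵢ` and column sums `qⱼ`. -/
def couplings {n m : ℕ} (p : Fin n → ℝ) (q : Fin m → ℝ) : Set (Matrix (Fin n) (Fin m) ℝ) :=
  {M | (∀ i j, 0 ≤ M i j) ∧ (∀ i, ∑ j, M i j = p i) ∧ (∀ j, ∑ i, M i j = q j)}

/-- Majorization `a ≼ b` of ordered vectors: every partial sum of `a` is at most that of `b`. -/
def Majorized {n : ℕ} (a b : Fin n → ℝ) : Prop :=
  ∀ i, ∑ j ∈ Finset.Iic i, a j ≤ ∑ j ∈ Finset.Iic i, b j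

/-- The greatest lower bound `z = p ∧ q` with respect to majorization, computed by
`zᵢ = min {∑_{j ≤ i} pⱼ, ∑_{j ≤ i} qⱼ} - ∑_{j < i} zⱼ`, where
`∑_{j < i} zⱼ = min {∑_{j < i} pⱼ, ∑_{j < i} qⱼ}`.  See `glb_spec`. -/
def glb {n : ℕ} (p q : Fin n → ℝ) (i : Fin n) : ℝ :=
  min (∑ j ∈ Finset.Iic i, p j) (∑ j ∈ Finset.Iic i, q j)
    - min (∑ j ∈ Finset.Iio i, p j) (∑ j ∈ Finset.Iio i, q j)

/-- A vector as an array with positions `1, …, n` (and `0` elsewhere). -/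
def arr {n : ℕ} (v : Fin n → ℝ) (i : ℕ) : ℝ :=
  if h : 1 ≤ i ∧ i ≤ n then v ⟨i - 1, by omega⟩ else 0

/-- The suffix sum `∑_{k=i}^n aₖ`. -/
def suffixSum (n : ℕ) (a : ℕ → ℝ) (i : ℕ) : ℝ := ∑ k ∈ Finset.Icc i n, a k

/-- The inversion points `i₀ = n + 1 > i₁ > i₂ > ⋯`: `iₛ` is the minimum index smaller than
`iₛ₋₁` such that, for all `i = iₛ, …, iₛ₋₁ - 1`, `∑_{k=i}^n pₖ ≥ ∑_{k=i}^n qₖ` if `s` is odd,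
and `∑_{k=i}^n pₖ ≤ ∑_{k=i}^n qₖ` if `s` is even. -/
def inversionPoint (n : ℕ) (p q : ℕ → ℝ) : ℕ → ℕ
  | 0 => n + 1
  | s + 1 => sInf {i | 1 ≤ i ∧ i < inversionPoint n p q s ∧
      ∀ l, i ≤ l → l ≤ inversionPoint n p q s - 1 →
        if Odd (s + 1) then suffixSum n q l ≤ suffixSum n p l
        else suffixSum n p l ≤ suffixSum n q l}

/-- The number `k` of the last inversion point: the minimum `k` with `iₖ = 1`. -/
def numInversions (n : ℕ) (p q : ℕ → ℝ) : ℕ := sInf {k | inversionPoint n p q k = 1}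

open Classical in
/-- The loop `while k ≤ j and sum + A[k] < x do Q ← Q ∪ {k}, sum ← sum + A[k], k ← k + 1`;
returns the final `Q` and `sum`. -/
def splitLoop (x : ℝ) (A : ℕ → ℝ) (j k : ℕ) (Q : Finset ℕ) (sum : ℝ) : Finset ℕ × ℝ :=
  if k ≤ j ∧ sum + A k < x then splitLoop x A j (k + 1) (insert k Q) (sum + A k)
  else (Q, sum)
termination_by j + 1 - k
decreasing_by omega

/-- The set `Q` returned by the splitting procedure called on `(z, x, A[i … j])`. -/
def splitSet (x : ℝ) (A : ℕ → ℝ) (i j : ℕ) : Finset ℕ := (splitLoop x A j i ∅ 0).1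

/-- The number `z⁽ᵈ⁾` returned by the splitting procedure called on `(z, x, A[i … j])`. -/
def splitDiag (x : ℝ) (A : ℕ → ℝ) (i j : ℕ) : ℝ := x - (splitLoop x A j i ∅ 0).2

/-- The number `z⁽ʳ⁾ = z - z⁽ᵈ⁾` returned by the splitting procedure. -/
def splitRest (z x : ℝ) (A : ℕ → ℝ) (i j : ℕ) : ℝ := z - splitDiag x A i j

/-- `forDownto f lo m` runs `f j` for `j = lo + m - 1` down to `lo`. -/
def forDownto {σ : Type} (f : ℕ → σ → σ) (lo : ℕ) : ℕ → σ → σ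
  | 0, st => st
  | m + 1, st => forDownto f lo m (f (lo + m) st)

open Classical in
/-- Body of the inner loop for odd `s`, with `hi = iₛ₋₁`: split `z_j` by the procedure called on
`(z_j, q_j, R[j+1 … hi-1])`; for each `ℓ ∈ Q` set `m_{ℓ j} ← R[ℓ]; R[ℓ] ← 0` (these assignments
concern distinct entries); then `m_{j j} ← z⁽ᵈ⁾, R[j] ← z⁽ʳ⁾`. -/
def oddStep (q z : ℕ → ℝ) (hi j : ℕ) (st : State) : State where
  M := fun a b =>
    if a = j ∧ b = j then splitDiag (q j) st.R (j + 1) (hi - 1)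
    else if a ∈ splitSet (q j) st.R (j + 1) (hi - 1) ∧ b = j then st.R a
    else st.M a b
  R := fun a =>
    if a = j then splitRest (z j) (q j) st.R (j + 1) (hi - 1)
    else if a ∈ splitSet (q j) st.R (j + 1) (hi - 1) then 0
    else st.R a
  C := st.C

open Classical in
/-- Body of the inner loop for even `s`: as `oddStep`, with rows and columns exchanged, `p`
instead of `q`, and `C` instead of `R`. -/
def evenStep (p z : ℕ → ℝ) (hi j : ℕ) (st : State) : State where
  M := fun a b =>
    if a = j ∧ b = j then splitDiag (p j) st.C (j + 1) (hi - 1)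
    else if a = j ∧ b ∈ splitSet (p j) st.C (j + 1) (hi - 1) then st.C b
    else st.M a b
  R := st.R
  C := fun b =>
    if b = j then splitRest (z j) (p j) st.C (j + 1) (hi - 1)
    else if b ∈ splitSet (p j) st.C (j + 1) (hi - 1) then 0
    else st.C b

open Classical in
/-- If `lo = iₛ ≠ 1`, for each `ℓ ∈ [lo … hi-1]` with `R[ℓ] ≠ 0` set
`m_{ℓ, lo-1} ← R[ℓ]; R[ℓ] ← 0`. -/
def oddFlush (lo hi : ℕ) (st : State) : State :=
  if lo ≠ 1 then
    { M := fun a b =>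
        if (lo ≤ a ∧ a ≤ hi - 1 ∧ st.R a ≠ 0) ∧ b = lo - 1 then st.R a else st.M a b
      R := fun a => if lo ≤ a ∧ a ≤ hi - 1 ∧ st.R a ≠ 0 then 0 else st.R a
      C := st.C }
  else st

open Classical in
/-- If `lo = iₛ ≠ 1`, for each `ℓ ∈ [lo … hi-1]` with `C[ℓ] ≠ 0` set
`m_{lo-1, ℓ} ← C[ℓ]; C[ℓ] ← 0`. -/
def evenFlush (lo hi : ℕ) (st : State) : State :=
  if lo ≠ 1 then
    { M := fun a b =>
        if a = lo - 1 ∧ (lo ≤ b ∧ b ≤ hi - 1 ∧ st.C b ≠ 0) then st.C b else st.M a b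
      R := st.R
      C := fun b => if lo ≤ b ∧ b ≤ hi - 1 ∧ st.C b ≠ 0 then 0 else st.C b }
  else st

/-- One iteration of the main loop, for a segment `lo = iₛ, …, hi - 1 = iₛ₋₁ - 1`. -/
def iteration (p q z : ℕ → ℝ) (s lo hi : ℕ) (st : State) : State :=
  if Odd s then oddFlush lo hi (forDownto (oddStep q z hi) lo (hi - lo) st)
  else evenFlush lo hi (forDownto (evenStep p z hi) lo (hi - lo) st)

/-- The state after the iterations `1, …, s` of the main loop. -/
def run (n : ℕ) (p q z : ℕ → ℝ) : ℕ → State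
  | 0 => ⟨fun _ _ => 0, fun _ => 0, fun _ => 0⟩
  | s + 1 => iteration p q z (s + 1) (inversionPoint n p q (s + 1)) (inversionPoint n p q s)
      (run n p q z s)

/-- The matrix computed by the main part of the algorithm (after the possible swap). -/
def mainMatrix {n : ℕ} (p q : Fin n → ℝ) : Matrix (Fin n) (Fin n) ℝ :=
  fun i j =>
    (run n (arr p) (arr q) (arr (glb p q)) (numInversions n (arr p) (arr q))).M (i + 1) (j + 1)

/-- The condition for the swap: `p ≠ q`, and `pᵢ < qᵢ` for `i = max {j | pⱼ ≠ qⱼ}`. -/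
def NeedsSwap {n : ℕ} (p q : Fin n → ℝ) : Prop :=
  ∃ i, p i < q i ∧ ∀ j, i < j → p j = q j

open Classical in
/-- The algorithm Min-Entropy-Joint-Distribution.  If `p` and `q` have been swapped, rows and
columns of the computed matrix are exchanged back, so that rows refer to the input `p` and columns
to the input `q`. -/
def minEntropyJointDistribution {n : ℕ} (p q : Fin n → ℝ) : Matrix (Fin n) (Fin n) ℝ :=
  if NeedsSwap p q then (mainMatrix q p).transpose else mainMatrix p q

theorem sum_glb {n : ℕ} (p q : Fin n → ℝ) (m : ℕ) (hm : m ≤ n) :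
    ∑ j with j.val < m, glb p q j
      = min (∑ j with j.val < m, p j) (∑ j with j.val < m, q j) := by
  induction m with
  | zero => simp
  | succ m ih =>
    have h1 : (Finset.univ.filter fun j : Fin n => j.val < m + 1)
        = insert ⟨m, hm⟩ (Finset.univ.filter fun j : Fin n => j.val < m) := by
      ext j
      simp only [Finset.mem_filter_univ, Finset.mem_insert, Fin.ext_iff]
      omega
    have h2 : (Finset.Iic (⟨m, hm⟩ : Fin n)) = Finset.univ.filter fun j : Fin n => j.val < m + 1 := by
      ext j
      simp only [Finset.mem_filter_univ, Finset.mem_Iic, Fin.le_def]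
      omega
    have h3 : (Finset.Iio (⟨m, hm⟩ : Fin n)) = Finset.univ.filter fun j : Fin n => j.val < m := by
      ext j
      simp only [Finset.mem_filter_univ, Finset.mem_Iio, Fin.lt_def]
    have h4 : ∑ j with j.val < m + 1, glb p q j
        = glb p q ⟨m, hm⟩ + ∑ j with j.val < m, glb p q j := by
      rw [h1, Finset.sum_insert (by simp)]
    rw [h4, ih (by omega), glb, h2, h3]
    ring

/-- For `p, q ∈ 𝒫ₙ`, `glb p q` is the greatest lower bound of `p` and `q` in `𝒫ₙ`. -/
theorem glb_spec {n : ℕ} {p q : Fin n → ℝ} (hp : p ∈ orderedProb n) (hq : q ∈ orderedProb n) :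
    glb p q ∈ orderedProb n ∧ Majorized (glb p q) p ∧ Majorized (glb p q) q ∧
      ∀ z ∈ orderedProb n, Majorized z p → Majorized z q → Majorized z (glb p q) := by
  obtain ⟨hp1, hp2, hp3⟩ := hp
  obtain ⟨hq1, hq2, hq3⟩ := hq
  have hI : ∀ i : Fin n,
      Finset.Iic i = Finset.univ.filter fun j : Fin n => j.val < i.val + 1 := by
    intro i
    ext j
    simp only [Finset.mem_filter_univ, Finset.mem_Iic, Fin.le_def]
    omega
  have hS : ∀ i, ∑ j ∈ Finset.Iic i, glb p q j
      = min (∑ j ∈ Finset.Iic i, p j) (∑ j ∈ Finset.Iic i, q j) := by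
    intro i
    rw [hI, sum_glb p q _ (by omega)]
  have hio : ∀ (v : Fin n → ℝ) (i : Fin n),
      ∑ j ∈ Finset.Iic i, v j = ∑ j ∈ Finset.Iio i, v j + v i := by
    intro v i
    rw [← Finset.Iio_insert, Finset.sum_insert (by simp)]; ring
  refine ⟨⟨?_, ?_, ?_⟩, ?_, ?_, ?_⟩
  · have key : ∀ (d : ℕ) (a b : Fin n), b.val = a.val + d → glb p q b ≤ glb p q a := by
      intro d
      induction d with
      | zero => intro a b h; rw [show b = a from Fin.ext (by simpa using h)]
      | succ d ih =>
        intro a b h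
        have hc : a.val + d < n := by omega
        refine le_trans ?_ (ih a ⟨a.val + d, hc⟩ rfl)
        set c : Fin n := ⟨a.val + d, hc⟩ with hcdef
        have hbc : Finset.Iio b = Finset.Iic c := by
          ext j
          simp only [Finset.mem_Iio, Finset.mem_Iic, Fin.lt_def, Fin.le_def, hcdef]
          omega
        have hcb : c ≤ b := by
          simp only [Fin.le_def, hcdef]
          omega
        have e1 := hp1 hcb
        have e2 := hq1 hcb
        have b1 := hio p b
        have b2 := hio q b
        have c1 := hio p c
        have c2 := hio q c
        rw [hbc] at b1 b2
        simp only [glb, hbc]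
        rcases le_total (∑ j ∈ Finset.Iic c, p j) (∑ j ∈ Finset.Iic c, q j) with h | h
        · rw [min_eq_left h]
          have := min_le_left (∑ j ∈ Finset.Iic b, p j) (∑ j ∈ Finset.Iic b, q j)
          have := min_le_left (∑ j ∈ Finset.Iio c, p j) (∑ j ∈ Finset.Iio c, q j)
          linarith
        · rw [min_eq_right h]
          have := min_le_right (∑ j ∈ Finset.Iic b, p j) (∑ j ∈ Finset.Iic b, q j)
          have := min_le_right (∑ j ∈ Finset.Iio c, p j) (∑ j ∈ Finset.Iio c, q j)
          linarith
    intro a b hab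
    exact key (b.val - a.val) a b (by have := Fin.le_def.1 hab; omega)
  · intro i
    have b1 := hio p i
    have b2 := hio q i
    have b3 := hp2 i
    have b4 := hq2 i
    simp only [glb, sub_nonneg]
    exact min_le_min (by linarith) (by linarith)
  · have h := sum_glb p q n le_rfl
    simpa [hp3, hq3] using h
  · intro i; rw [hS]; exact min_le_left _ _
  · intro i; rw [hS]; exact min_le_right _ _
  · intro z _ h1 h2 i; rw [hS]; exact le_min (h1 i) (h2 i)

end

end MinEntropyCoupling

namespace MinEntropyCoupling

noncomputable section

/-! Write `P i`, `Q i` for the suffix sums of `p`, `q`. Since the totals agree, `z i = max (P i) (Q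
i) - max (P (i+1)) (Q (i+1))`. On an odd segment `[lo, hi)`, `P` dominates `Q`, so `z i = p i`
except possibly at `i = hi - 1`, whose row already holds `p i - z i`.

While the columns of the segment are filled downwards, treated columns are full and `R a` is what
row `a` still owes; the debts at stage `j < hi` add up to `P j - Q j`. Column `j` takes a prefix of
the debts and a diagonal entry `d`, and the crux is `0 ≤ d ≤ z j` (`SegmentInv.oddStep`). If the
prefix stops at `t`, then `d ≤ R t ≤ z t ≤ z j` because `z` is antitone; if all debts are used, `d =
Q j - max (P (j+1)) (Q (j+1)) ≤ z j`.

At an inversion point the remaining debts go to column `lo - 1`, which produces the initial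
situation of the next segment with `p` and `q` exchanged (`SegmentInv.oddFlush`). Even iterations
are transposed odd ones. When a segment ends at `1`, the total debt is `P 1 - Q 1 = 0`, so every row
is full. -/

theorem suffixSum_eq_add {n j : ℕ} (a : ℕ → ℝ) (hj : j ≤ n) :
    suffixSum n a j = a j + suffixSum n a (j + 1) := by
  unfold suffixSum
  rw [← Finset.add_sum_Ioc_eq_sum_Icc hj, ← Finset.Icc_add_one_left_eq_Ioc]

theorem suffixSum_succ_self (n : ℕ) (a : ℕ → ℝ) : suffixSum n a (n + 1) = 0 := by
  simp [suffixSum]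

/-! ### The splitting procedure. -/

/-- The splitting loop reads a prefix of the array, and stops at its end or when the target
is reached. -/
theorem splitLoop_spec (x : ℝ) (A : ℕ → ℝ) (j : ℕ) :
    ∀ (d k : ℕ) (Q : Finset ℕ) (s : ℝ), k + d = j + 1 → s ≤ x →
      ∃ t, k ≤ t ∧ t ≤ j + 1 ∧ (splitLoop x A j k Q s).1 = Q ∪ Finset.Ico k t ∧
        (splitLoop x A j k Q s).2 = s + ∑ i ∈ Finset.Ico k t, A i ∧
        s + ∑ i ∈ Finset.Ico k t, A i ≤ x ∧
        (t ≤ j → x ≤ s + ∑ i ∈ Finset.Ico k t, A i + A t) := by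
  intro d
  induction d with
  | zero =>
    intro k Q s hk hs
    refine ⟨k, le_rfl, by omega, ?_⟩
    rw [splitLoop, if_neg (by omega)]
    simp only [Finset.Ico_self, Finset.union_empty, Finset.sum_empty, add_zero, true_and]
    exact ⟨hs, fun h => by omega⟩
  | succ d ih =>
    intro k Q s hk hs
    by_cases hc : s + A k < x
    · obtain ⟨t, h1, h2, h3, h4, h5, h6⟩ := ih (k + 1) (insert k Q) (s + A k) (by omega) hc.le
      have hsum : ∑ i ∈ Finset.Ico k t, A i = A k + ∑ i ∈ Finset.Ico (k + 1) t, A i :=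
        Finset.sum_eq_sum_Ico_succ_bot (by omega) A
      refine ⟨t, by omega, h2, ?_⟩
      rw [splitLoop, if_pos ⟨by omega, hc⟩, h3, h4, hsum]
      refine ⟨?_, by ring, by linarith, fun h => by linarith [h6 h]⟩
      ext i
      simp only [Finset.mem_union, Finset.mem_insert, Finset.mem_Ico]
      grind
    · refine ⟨k, le_rfl, by omega, ?_⟩
      rw [splitLoop, if_neg (by tauto)]
      simp only [Finset.Ico_self, Finset.union_empty, Finset.sum_empty, add_zero, true_and]
      exact ⟨hs, fun _ => not_lt.1 hc⟩

/-- The last clause compares the diagonal part with the first unread entry; this is what later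
bounds it by `z`. No sign condition on `A` is needed, as the loop never lets the sum pass `x`. -/
theorem split_spec {x : ℝ} (A : ℕ → ℝ) {i j : ℕ} (hij : i ≤ j + 1) (hx : 0 ≤ x) :
    ∃ t, i ≤ t ∧ t ≤ j + 1 ∧ splitSet x A i j = Finset.Ico i t ∧
      splitDiag x A i j = x - ∑ l ∈ Finset.Ico i t, A l ∧
      0 ≤ splitDiag x A i j ∧ (t ≤ j → splitDiag x A i j ≤ A t) := by
  obtain ⟨t, h1, h2, h3, h4, h5, h6⟩ :=
    splitLoop_spec x A j (j + 1 - i) i ∅ 0 (by omega) hx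
  rw [zero_add] at h4 h5 h6
  refine ⟨t, h1, h2, by simpa [splitSet] using h3, by rw [splitDiag, h4], ?_, fun h => ?_⟩
  · rw [splitDiag, h4]; linarith
  · rw [splitDiag, h4]; linarith [h6 h]

/-! ### Transposition symmetry between even and odd iterations. -/

/-- Exchange of rows and columns. -/
def State.swap (st : State) : State := ⟨fun a b => st.M b a, st.C, st.R⟩

theorem evenStep_eq_swap (p z : ℕ → ℝ) (hi j : ℕ) (st : State) :
    evenStep p z hi j st = (oddStep p z hi j st.swap).swap := by
  simp only [evenStep, oddStep, State.swap, State.mk.injEq, true_and]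
  refine ⟨?_, rfl⟩
  funext a b
  simp only [and_comm]

theorem evenFlush_eq_swap (lo hi : ℕ) (st : State) :
    evenFlush lo hi st = (oddFlush lo hi st.swap).swap := by
  unfold evenFlush oddFlush
  split_ifs
  · simp only [State.swap, State.mk.injEq, true_and]
    refine ⟨?_, rfl⟩
    funext a b
    exact if_congr and_comm rfl rfl
  · rfl

theorem forDownto_evenStep_eq_swap (p z : ℕ → ℝ) (hi lo m : ℕ) (st : State) :
    forDownto (evenStep p z hi) lo m st = (forDownto (oddStep p z hi) lo m st.swap).swap := by
  induction m generalizing st with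
  | zero => rfl
  | succ m ih => rw [forDownto, ih, forDownto, evenStep_eq_swap]; rfl

/-- With this, only odd iterations have to be analysed. -/
theorem iteration_of_not_odd {s : ℕ} (hs : ¬ Odd s) (p q z : ℕ → ℝ) (lo hi : ℕ) (st : State) :
    (iteration p q z s lo hi st).swap
      = oddFlush lo hi (forDownto (oddStep p z hi) lo (hi - lo) st.swap) := by
  rw [iteration, if_neg hs, evenFlush_eq_swap, forDownto_evenStep_eq_swap]
  rfl

/-! ### A single segment of the main loop. -/

/-- The invariant of the inner loop of an odd iteration with top `hi`, when the positions
`j, …, n` have been treated. -/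
structure SegmentInv (n : ℕ) (p q z : ℕ → ℝ) (hi j : ℕ) (st : State) : Prop where
  nonneg : ∀ a b, 0 ≤ st.M a b
  col_zero : ∀ a b, b < j → st.M a b = 0
  row_zero : ∀ a b, a + 1 < hi → a < j → st.M a b = 0
  -- Row `hi - 1` is the one that received the flush of the preceding segment.
  row_top : ∀ a, a + 1 = hi → a < j → ∑ b ∈ Finset.Icc 1 n, st.M a b = p a - z a
  row_done : ∀ a, hi ≤ a → a ≤ n → ∑ b ∈ Finset.Icc 1 n, st.M a b = p a
  row_active : ∀ a, j ≤ a → a < hi → ∑ b ∈ Finset.Icc 1 n, st.M a b + st.R a = p a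
  col_done : ∀ b, j ≤ b → b ≤ n → ∑ a ∈ Finset.Icc 1 n, st.M a b = q b
  rest_nonneg : ∀ a, j ≤ a → a < hi → 0 ≤ st.R a
  rest_le : ∀ a, j ≤ a → a < hi → st.R a ≤ z a
  -- The `max` matters only at `j = hi`: there `q` may have the larger suffix sum, while the sum on
  -- the left is empty.
  rest_sum : ∑ a ∈ Finset.Ico j hi, st.R a
    = max (suffixSum n p j) (suffixSum n q j) - suffixSum n q j

theorem sum_add_column (n : ℕ) (M : ℕ → ℕ → ℝ) (e : ℕ → ℝ) {c : ℕ} (h1 : 1 ≤ c) (h2 : c ≤ n)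
    (a : ℕ) :
    ∑ b ∈ Finset.Icc 1 n, (M a b + if b = c then e a else 0)
      = ∑ b ∈ Finset.Icc 1 n, M a b + e a := by
  rw [Finset.sum_add_distrib, Finset.sum_ite_eq' , if_pos (Finset.mem_Icc.2 ⟨h1, h2⟩)]

/-- The data of a segment `[lo, hi)` on which the suffix sums of `p` dominate those of `q`. -/
structure IsSegment (n : ℕ) (p q z : ℕ → ℝ) (lo hi : ℕ) : Prop where
  one_le : 1 ≤ lo
  lt : lo < hi
  le : hi ≤ n + 1
  dom : ∀ i, lo ≤ i → i < hi → suffixSum n q i ≤ suffixSum n p i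
  q_nonneg : ∀ i, 0 ≤ q i
  glb_antitone : ∀ i j, 1 ≤ i → i ≤ j → j ≤ n → z j ≤ z i
  glb_eq : ∀ i, 1 ≤ i → i ≤ n → z i = max (suffixSum n p i) (suffixSum n q i)
    - max (suffixSum n p (i + 1)) (suffixSum n q (i + 1))

theorem SegmentInv.oddStep {n : ℕ} {p q z : ℕ → ℝ} {lo hi j : ℕ} {st : State}
    (hseg : IsSegment n p q z lo hi) (h : SegmentInv n p q z hi (j + 1) st)
    (hlo : lo ≤ j) (hj : j < hi) : SegmentInv n p q z hi j (oddStep q z hi j st) := by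
  have h1 := hseg.one_le
  have hn := hseg.le
  obtain ⟨t, ht1, ht2, hset, hdiag, hd0, hdt⟩ :=
    split_spec (x := q j) st.R (i := j + 1) (j := hi - 1) (by omega) (hseg.q_nonneg j)
  have hhi : hi - 1 + 1 = hi := by omega
  rw [hhi] at ht2
  set d := splitDiag (q j) st.R (j + 1) (hi - 1) with hdef
  have hz := hseg.glb_eq j (by omega) (by omega)
  have hp' := suffixSum_eq_add p (show j ≤ n by omega)
  have hq' := suffixSum_eq_add q (show j ≤ n by omega)
  have hdz : d ≤ z j := by
    -- Either all residuals were read, and `rest_sum` gives `d` exactly, or the loop stopped at `t <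
    -- hi` and `d` is at most the residual there.
    rcases eq_or_lt_of_le ht2 with rfl | ht
    · have := h.rest_sum
      have := le_max_right (suffixSum n p j) (suffixSum n q j)
      linarith
    · exact (hdt (by omega)).trans ((h.rest_le t ht1 ht).trans
        (hseg.glb_antitone j t (by omega) (by omega) (by omega)))
  -- `e` is the new column `j`. That column was zero before, so the assignments amount to adding `e`
  -- to it.
  let e : ℕ → ℝ := fun a => if a = j then d else if a ∈ Finset.Ico (j + 1) t then st.R a else 0
  have hM : ∀ a b, (MinEntropyCoupling.oddStep q z hi j st).M a b
      = st.M a b + if b = j then e a else 0 := by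
    intro a b
    simp only [MinEntropyCoupling.oddStep, ← hdef, hset, e]
    by_cases hb : b = j
    · subst hb
      rw [h.col_zero a b (by omega)]
      simp
    · simp [hb]
  have hRj : (MinEntropyCoupling.oddStep q z hi j st).R j = z j - d := by
    simp [MinEntropyCoupling.oddStep, splitRest, ← hdef]
  have hR : ∀ a, a ≠ j → (MinEntropyCoupling.oddStep q z hi j st).R a = st.R a - e a := by
    intro a ha
    simp only [MinEntropyCoupling.oddStep, hset, e, if_neg ha]
    split_ifs <;> simp
  have he : ∀ a, 0 ≤ e a := by
    intro a
    simp only [e]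
    split_ifs with h3 h4
    · exact hd0
    · rw [Finset.mem_Ico] at h4
      exact h.rest_nonneg a h4.1 (by omega)
    · exact le_rfl
  have hej : e j = d := by simp [e]
  have heR : ∀ a, j < a → a < hi → e a ≤ st.R a := by
    intro a ha1 ha2
    simp only [e, if_neg ha1.ne']
    split_ifs
    · exact le_rfl
    · exact h.rest_nonneg a ha1 ha2
  have he0 : ∀ a, a < j ∨ hi ≤ a → e a = 0 := by
    intro a ha
    simp only [e]
    rw [if_neg (by omega), if_neg (by rw [Finset.mem_Ico]; omega)]
  have heS : ∑ a ∈ Finset.Ico (j + 1) hi, e a = q j - d := by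
    rw [← Finset.sum_Ico_consecutive e ht1 ht2]
    have e1 : ∑ a ∈ Finset.Ico (j + 1) t, e a = ∑ a ∈ Finset.Ico (j + 1) t, st.R a := by
      refine Finset.sum_congr rfl fun a ha => ?_
      have := Finset.mem_Ico.1 ha
      simp only [e]
      rw [if_neg (by omega), if_pos ha]
    have e2 : ∑ a ∈ Finset.Ico t hi, e a = 0 := by
      refine Finset.sum_eq_zero fun a ha => ?_
      have := Finset.mem_Ico.1 ha
      simp only [e]
      rw [if_neg (by omega), if_neg (by rw [Finset.mem_Ico]; omega)]
    rw [e1, e2, hdiag]; ring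
  have heT : ∑ a ∈ Finset.Icc 1 n, e a = q j := by
    have : ∑ a ∈ Finset.Icc 1 n, e a = ∑ a ∈ Finset.Ico j hi, e a := by
      symm
      apply Finset.sum_subset
      · intro a; simp only [Finset.mem_Ico, Finset.mem_Icc]; omega
      · intro a _ ha
        rw [Finset.mem_Ico] at ha
        exact he0 a (by omega)
    rw [this, Finset.sum_eq_sum_Ico_succ_bot hj, heS, hej]; ring
  have hrow : ∀ a, ∑ b ∈ Finset.Icc 1 n, (MinEntropyCoupling.oddStep q z hi j st).M a b
      = ∑ b ∈ Finset.Icc 1 n, st.M a b + e a := by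
    intro a
    simp only [hM]
    exact sum_add_column n st.M e (by omega) (by omega) a
  constructor
  · intro a b
    rw [hM]
    refine add_nonneg (h.nonneg a b) ?_
    split_ifs
    · exact he a
    · exact le_rfl
  · intro a b hb
    rw [hM, h.col_zero a b (by omega), if_neg (by omega), add_zero]
  · intro a b ha1 ha2
    rw [hM, h.row_zero a b ha1 (by omega), he0 a (by omega)]
    simp
  · intro a ha1 ha2
    omega
  · intro a ha1 ha2
    rw [hrow, h.row_done a ha1 ha2, he0 a (by omega), add_zero]
  · intro a ha1 ha2
    rw [hrow]
    rcases eq_or_lt_of_le ha1 with rfl | ha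
    · rw [hRj, hej]
      by_cases hjt : j + 1 = hi
      · rw [h.row_top j hjt (by omega)]; ring
      · rw [Finset.sum_eq_zero fun b _ => h.row_zero j b (by omega) (by omega)]
        rw [max_eq_left (hseg.dom j hlo hj), max_eq_left (hseg.dom (j + 1) (by omega) (by omega))]
          at hz
        linarith
    · rw [hR a (by omega), ← h.row_active a ha ha2]; ring
  · intro b hb1 hb2
    simp only [hM]
    rw [Finset.sum_add_distrib]
    rcases eq_or_lt_of_le hb1 with rfl | hb
    · rw [Finset.sum_eq_zero fun a _ => h.col_zero a j (by omega)]
      simp [heT]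
    · rw [h.col_done b hb hb2]
      simp [hb.ne']
  · intro a ha1 ha2
    rcases eq_or_lt_of_le ha1 with rfl | ha
    · rw [hRj]; linarith
    · rw [hR a (by omega)]; linarith [heR a ha ha2]
  · intro a ha1 ha2
    rcases eq_or_lt_of_le ha1 with rfl | ha
    · rw [hRj]; linarith
    · rw [hR a (by omega)]; linarith [he a, h.rest_le a ha ha2]
  · have hsum : ∑ a ∈ Finset.Ico (j + 1) hi, (MinEntropyCoupling.oddStep q z hi j st).R a
        = ∑ a ∈ Finset.Ico (j + 1) hi, (st.R a - e a) := by
      refine Finset.sum_congr rfl fun a ha => hR a ?_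
      rw [Finset.mem_Ico] at ha
      omega
    rw [Finset.sum_eq_sum_Ico_succ_bot hj, hsum, Finset.sum_sub_distrib, heS, h.rest_sum, hRj]
    linarith

theorem SegmentInv.forDownto {n : ℕ} {p q z : ℕ → ℝ} {lo hi : ℕ}
    (hseg : IsSegment n p q z lo hi) :
    ∀ (m : ℕ) (st : State), lo + m ≤ hi → SegmentInv n p q z hi (lo + m) st →
      SegmentInv n p q z hi lo (forDownto (MinEntropyCoupling.oddStep q z hi) lo m st) := by
  intro m
  induction m with
  | zero => intro st _ h; exact h
  | succ m ih =>
    intro st hm h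
    exact ih _ (by omega) (SegmentInv.oddStep hseg h (by omega) (by omega))

/-- The residuals total `suffixSum n p lo - suffixSum n q lo`. Dominance changes sides at `lo - 1`,
so `z (lo - 1) = suffixSum n q (lo - 1) - suffixSum n p lo`, and this total is `q (lo - 1) - z (lo -
1)`, as `row_top` of the transposed state requires. -/
theorem SegmentInv.oddFlush {n : ℕ} {p q z : ℕ → ℝ} {lo hi : ℕ} {st : State}
    (hseg : IsSegment n p q z lo hi) (h : SegmentInv n p q z hi lo st) (hlo : lo ≠ 1)
    (hdom : suffixSum n p (lo - 1) ≤ suffixSum n q (lo - 1)) :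
    SegmentInv n q p z lo lo (oddFlush lo hi st).swap := by
  have h1 := hseg.one_le
  have hlt := hseg.lt
  have hn := hseg.le
  obtain ⟨c, rfl⟩ : ∃ c, lo = c + 1 := ⟨lo - 1, by omega⟩
  rw [Nat.add_sub_cancel] at hdom
  let e : ℕ → ℝ := fun a => if a ∈ Finset.Ico (c + 1) hi then st.R a else 0
  have hM : ∀ a b, (MinEntropyCoupling.oddFlush (c + 1) hi st).swap.M b a
      = st.M a b + if b = c then e a else 0 := by
    intro a b
    simp only [MinEntropyCoupling.oddFlush, if_pos hlo, State.swap, Nat.add_sub_cancel, e,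
      Finset.mem_Ico]
    by_cases hb : b = c
    · subst hb
      rw [h.col_zero a b (by omega)]
      have : a ≤ hi - 1 ↔ a < hi := by omega
      simp only [this, and_true, if_true, zero_add]
      -- The test `R a ≠ 0` is harmless: a skipped entry is already zero.
      by_cases hR : st.R a = 0
      · simp [hR]
      · simp [hR]
    · simp [hb]
  have he : ∀ a, 0 ≤ e a := by
    intro a
    simp only [e]
    split_ifs with h4
    · rw [Finset.mem_Ico] at h4
      exact h.rest_nonneg a h4.1 h4.2
    · exact le_rfl
  have heT : ∑ a ∈ Finset.Icc 1 n, e a = ∑ a ∈ Finset.Ico (c + 1) hi, st.R a := by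
    simp only [e]
    rw [← Finset.sum_filter]
    refine Finset.sum_congr ?_ fun _ _ => rfl
    ext a
    simp only [Finset.mem_filter, Finset.mem_Icc, Finset.mem_Ico]
    omega
  have hrow : ∀ a, ∑ b ∈ Finset.Icc 1 n, (MinEntropyCoupling.oddFlush (c + 1) hi st).swap.M b a
      = ∑ b ∈ Finset.Icc 1 n, st.M a b + e a := by
    intro a
    simp only [hM]
    exact sum_add_column n st.M e (by omega) (by omega) a
  have hz := hseg.glb_eq c (by omega) (by omega)
  have hq' := suffixSum_eq_add q (show c ≤ n by omega)
  have hd := hseg.dom (c + 1) le_rfl hlt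
  constructor
  · intro b a
    rw [hM]
    refine add_nonneg (h.nonneg a b) ?_
    split_ifs
    · exact he a
    · exact le_rfl
  · intro b a ha
    rw [hM, h.row_zero a b (by omega) ha]
    have : e a = 0 := if_neg (by rw [Finset.mem_Ico]; omega)
    simp [this]
  · intro b a hb _
    rw [hM, h.col_zero a b (by omega), if_neg (by omega), add_zero]
  · intro b hb _
    obtain rfl : b = c := by omega
    simp only [hM, if_true]
    rw [Finset.sum_add_distrib, Finset.sum_eq_zero fun a _ => h.col_zero a b (by omega), heT,
      h.rest_sum, hz, max_eq_right hdom]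
    linarith
  · intro b hb1 hb2
    simp only [hM, if_neg (show b ≠ c by omega), add_zero]
    exact h.col_done b hb1 hb2
  · intro b hb1 hb2
    omega
  · intro a ha1 ha2
    rw [hrow]
    by_cases ha : a < hi
    · rw [← h.row_active a ha1 ha]
      simp only [e]
      rw [if_pos (Finset.mem_Ico.2 ⟨ha1, ha⟩)]
    · rw [h.row_done a (by omega) ha2]
      simp only [e]
      rw [if_neg (by rw [Finset.mem_Ico]; omega), add_zero]
  · intro b hb1 hb2
    omega
  · intro b hb1 hb2
    omega
  · rw [Finset.Ico_self, Finset.sum_empty, max_eq_right hd, sub_self]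

/-- `M` restricted to `[1, n] × [1, n]` is a coupling of `p` and `q`. -/
structure IsCouplingArray (n : ℕ) (p q : ℕ → ℝ) (M : ℕ → ℕ → ℝ) : Prop where
  nonneg : ∀ a b, 0 ≤ M a b
  row : ∀ a, 1 ≤ a → a ≤ n → ∑ b ∈ Finset.Icc 1 n, M a b = p a
  col : ∀ b, 1 ≤ b → b ≤ n → ∑ a ∈ Finset.Icc 1 n, M a b = q b

/-- With equal totals the nonnegative residuals sum to zero, so each vanishes. -/
theorem SegmentInv.isCouplingArray {n : ℕ} {p q z : ℕ → ℝ} {hi : ℕ} {st : State}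
    (h : SegmentInv n p q z hi 1 st) (htot : suffixSum n p 1 = suffixSum n q 1) :
    IsCouplingArray n p q st.M := by
  refine ⟨h.nonneg, fun a ha1 ha2 => ?_, fun b hb1 hb2 => h.col_done b hb1 hb2⟩
  by_cases ha : a < hi
  · have hs := h.rest_sum
    rw [htot, max_self, sub_self, Finset.sum_eq_zero_iff_of_nonneg] at hs
    · rw [← h.row_active a ha1 ha, hs a (Finset.mem_Ico.2 ⟨ha1, ha⟩), add_zero]
    · intro i hi'
      rw [Finset.mem_Ico] at hi'
      exact h.rest_nonneg i hi'.1 hi'.2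
  · exact h.row_done a (by omega) ha2

/-! ### Inversion points and the main loop. -/

/-- By minimality the inequality of the current parity fails just below the new point, hence the
reverse one holds there. That is `hdom` for the next index, so the lemma can be iterated. -/
theorem inversionPoint_succ_spec {n : ℕ} {p q : ℕ → ℝ} {s : ℕ}
    (h1 : 1 < inversionPoint n p q s)
    (hdom : if Odd (s + 1)
      then suffixSum n q (inversionPoint n p q s - 1) ≤ suffixSum n p (inversionPoint n p q s - 1)
      else suffixSum n p (inversionPoint n p q s - 1)
        ≤ suffixSum n q (inversionPoint n p q s - 1)) :
    1 ≤ inversionPoint n p q (s + 1) ∧ inversionPoint n p q (s + 1) < inversionPoint n p q s ∧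
      (∀ l, inversionPoint n p q (s + 1) ≤ l → l < inversionPoint n p q s →
        if Odd (s + 1) then suffixSum n q l ≤ suffixSum n p l
        else suffixSum n p l ≤ suffixSum n q l) ∧
      (inversionPoint n p q (s + 1) ≠ 1 →
        if Odd (s + 2)
        then suffixSum n q (inversionPoint n p q (s + 1) - 1)
          ≤ suffixSum n p (inversionPoint n p q (s + 1) - 1)
        else suffixSum n p (inversionPoint n p q (s + 1) - 1)
          ≤ suffixSum n q (inversionPoint n p q (s + 1) - 1)) := by
  set hi := inversionPoint n p q s with hhi
  set S := {i | 1 ≤ i ∧ i < hi ∧ ∀ l, i ≤ l → l ≤ hi - 1 →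
        if Odd (s + 1) then suffixSum n q l ≤ suffixSum n p l
        else suffixSum n p l ≤ suffixSum n q l} with hS
  have hlo : inversionPoint n p q (s + 1) = sInf S := by rw [inversionPoint, hS]
  have hmem : sInf S ∈ S := by
    -- The set must be nonempty, since `sInf ∅ = 0` would not be a position; `hdom` supplies the
    -- witness `hi - 1`.
    refine Nat.sInf_mem ⟨hi - 1, by omega, by omega, fun l hl1 hl2 => ?_⟩
    rw [show l = hi - 1 by omega]
    exact hdom
  rw [hlo]
  refine ⟨hmem.1, hmem.2.1, fun l hl1 hl2 => hmem.2.2 l hl1 (by omega), fun hne => ?_⟩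
  have hmin : sInf S - 1 ∉ S := Nat.notMem_of_lt_sInf (by have := hmem.1; omega)
  by_contra hcon
  refine hmin ⟨by have := hmem.1; omega, by have := hmem.2.1; omega, fun l hl1 hl2 => ?_⟩
  rcases eq_or_lt_of_le hl1 with rfl | hl
  · by_cases ho : Odd (s + 1)
    · rw [if_neg (by simpa [Nat.odd_add_one] using ho)] at hcon
      rw [if_pos ho]
      exact (not_le.1 hcon).le
    · rw [if_pos (by simpa [Nat.odd_add_one] using ho)] at hcon
      rw [if_neg ho]
      exact (not_le.1 hcon).le
  · exact hmem.2.2 l (by omega) hl2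

/-- The hypotheses on the arrays under which the main loop is correct. -/
structure IsInput (n : ℕ) (p q z : ℕ → ℝ) : Prop where
  p_nonneg : ∀ i, 0 ≤ p i
  q_nonneg : ∀ i, 0 ≤ q i
  total : suffixSum n p 1 = suffixSum n q 1
  glb_antitone : ∀ i j, 1 ≤ i → i ≤ j → j ≤ n → z j ≤ z i
  glb_eq : ∀ i, 1 ≤ i → i ≤ n → z i = max (suffixSum n p i) (suffixSum n q i)
    - max (suffixSum n p (i + 1)) (suffixSum n q (i + 1))

theorem IsInput.swap {n : ℕ} {p q z : ℕ → ℝ} (h : IsInput n p q z) : IsInput n q p z where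
  p_nonneg := h.q_nonneg
  q_nonneg := h.p_nonneg
  total := h.total.symm
  glb_antitone := h.glb_antitone
  glb_eq i h1 h2 := by
    rw [h.glb_eq i h1 h2, max_comm, max_comm (suffixSum n p (i + 1))]

theorem IsInput.isSegment {n : ℕ} {p q z : ℕ → ℝ} (h : IsInput n p q z) {lo hi : ℕ}
    (h1 : 1 ≤ lo) (h2 : lo < hi) (h3 : hi ≤ n + 1)
    (hdom : ∀ i, lo ≤ i → i < hi → suffixSum n q i ≤ suffixSum n p i) :
    IsSegment n p q z lo hi :=
  ⟨h1, h2, h3, hdom, h.q_nonneg, h.glb_antitone, h.glb_eq⟩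

theorem SegmentInv.segment {n : ℕ} {p q z : ℕ → ℝ} {lo hi : ℕ} {st : State}
    (hseg : IsSegment n p q z lo hi) (h : SegmentInv n p q z hi hi st) :
    SegmentInv n p q z hi lo
      (MinEntropyCoupling.forDownto (MinEntropyCoupling.oddStep q z hi) lo (hi - lo) st) := by
  have := hseg.lt
  refine SegmentInv.forDownto hseg (hi - lo) st (by omega) ?_
  rwa [show lo + (hi - lo) = hi by omega]

/-- The invariant of the main loop after `s` iterations. -/
structure LoopInv (n : ℕ) (p q z : ℕ → ℝ) (s : ℕ) : Prop where
  one_lt : 1 < inversionPoint n p q s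
  le : inversionPoint n p q s + s ≤ n + 1
  dom : if Odd (s + 1)
      then suffixSum n q (inversionPoint n p q s - 1) ≤ suffixSum n p (inversionPoint n p q s - 1)
      else suffixSum n p (inversionPoint n p q s - 1) ≤ suffixSum n q (inversionPoint n p q s - 1)
  inv : if Odd (s + 1)
    then SegmentInv n p q z (inversionPoint n p q s) (inversionPoint n p q s) (run n p q z s)
    else SegmentInv n q p z (inversionPoint n p q s) (inversionPoint n p q s) (run n p q z s).swap

/-- From `q n ≤ p n` one gets `z n = p n`, so the empty row `n` satisfies `row_top`. -/
theorem LoopInv.zero {n : ℕ} {p q z : ℕ → ℝ} (hn : 1 ≤ n) (h : IsInput n p q z)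
    (hlast : q n ≤ p n) : LoopInv n p q z 0 := by
  have hp := suffixSum_eq_add p (le_refl n)
  have hq := suffixSum_eq_add q (le_refl n)
  have hz := h.glb_eq n hn le_rfl
  rw [suffixSum_succ_self] at hp hq
  simp only [suffixSum_succ_self, max_self, sub_zero, hp, hq, add_zero, max_eq_left hlast] at hz
  refine ⟨by simp [inversionPoint]; omega, by simp [inversionPoint], ?_, ?_⟩
  · simpa [inversionPoint, hp, hq] using hlast
  · rw [if_pos (by decide)]
    simp only [inversionPoint, run]
    constructor <;> try simp
    · simp [hz]
    all_goals first
      | (intros; omega)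
      | simp [suffixSum_succ_self]

theorem LoopInv.succ {n : ℕ} {p q z : ℕ → ℝ} {s : ℕ} (hin : IsInput n p q z)
    (h : LoopInv n p q z s) (hne : inversionPoint n p q (s + 1) ≠ 1) :
    LoopInv n p q z (s + 1) := by
  obtain ⟨h1, h2, h3, h4⟩ := inversionPoint_succ_spec h.one_lt h.dom
  have hle := h.le
  have hd := h4 hne
  refine ⟨by omega, by omega, hd, ?_⟩
  have hinv := h.inv
  by_cases ho : Odd (s + 1)
  · have ho' : ¬ Odd (s + 1 + 1) := by simpa [Nat.odd_add_one] using ho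
    simp only [if_pos ho] at h3 hinv
    simp only [if_neg ho'] at hd ⊢
    have hseg := hin.isSegment h1 h2 (by omega) h3
    rw [run, iteration, if_pos ho]
    exact SegmentInv.oddFlush hseg (SegmentInv.segment hseg hinv) hne hd
  · have ho' : Odd (s + 1 + 1) := by simpa [Nat.odd_add_one] using ho
    simp only [if_neg ho] at h3 hinv
    simp only [if_pos ho'] at hd ⊢
    have hseg := hin.swap.isSegment h1 h2 (by omega) h3
    have := SegmentInv.oddFlush hseg (SegmentInv.segment hseg hinv) hne hd
    rw [← iteration_of_not_odd ho p q] at this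
    exact this

theorem LoopInv.isCouplingArray {n : ℕ} {p q z : ℕ → ℝ} {s : ℕ} (hin : IsInput n p q z)
    (h : LoopInv n p q z s) (heq : inversionPoint n p q (s + 1) = 1) :
    IsCouplingArray n p q (run n p q z (s + 1)).M := by
  obtain ⟨h1, h2, h3, -⟩ := inversionPoint_succ_spec h.one_lt h.dom
  have hle := h.le
  have hinv := h.inv
  rw [heq] at h1 h2 h3
  rw [run, heq]
  by_cases ho : Odd (s + 1)
  · simp only [if_pos ho] at h3 hinv
    have hseg := hin.isSegment h1 h2 (by omega) h3
    rw [iteration, if_pos ho, oddFlush, if_neg (by simp)]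
    exact (SegmentInv.segment hseg hinv).isCouplingArray hin.total
  · simp only [if_neg ho] at h3 hinv
    have hseg := hin.swap.isSegment h1 h2 (by omega) h3
    have := (SegmentInv.segment hseg hinv).isCouplingArray hin.swap.total
    have heq' := iteration_of_not_odd ho p q z 1 (inversionPoint n p q s) (run n p q z s)
    rw [oddFlush, if_neg (by simp)] at heq'
    rw [← heq'] at this
    exact ⟨fun a b => this.nonneg b a, this.col, this.row⟩

theorem isCouplingArray_run {n : ℕ} {p q z : ℕ → ℝ} (hn : 1 ≤ n) (hin : IsInput n p q z)
    (hlast : q n ≤ p n) : IsCouplingArray n p q (run n p q z (numInversions n p q)).M := by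
  have hloop : ∀ s, (∀ t ≤ s, inversionPoint n p q t ≠ 1) → LoopInv n p q z s := by
    intro s
    induction s with
    | zero => intro _; exact LoopInv.zero hn hin hlast
    | succ s ih =>
      intro hs
      exact (ih fun t ht => hs t (by omega)).succ hin (hs _ le_rfl)
  have hex : ∃ k, inversionPoint n p q k = 1 := by
    -- The points drop by at least one each time, so they cannot stay above `1` for `n + 1`
    -- iterations.
    by_contra! hcon
    have hl := hloop (n + 1) fun t _ => hcon t
    have := hl.le
    have := hl.one_lt
    omega
  have hk : inversionPoint n p q (numInversions n p q) = 1 := Nat.sInf_mem hex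
  have hmin : ∀ t, t < numInversions n p q → inversionPoint n p q t ≠ 1 :=
    fun t ht => Nat.notMem_of_lt_sInf (s := {k | inversionPoint n p q k = 1}) ht
  rcases hK : numInversions n p q with _ | s
  · rw [hK, inversionPoint] at hk
    omega
  · rw [hK] at hk hmin
    exact (hloop s fun t ht => hmin t (by omega)).isCouplingArray hin hk

/-! ### From arrays back to vectors indexed by `Fin n`. -/

theorem arr_succ {n : ℕ} (v : Fin n → ℝ) (i : Fin n) : arr v (i + 1) = v i := by
  have := i.2
  simp [arr]

theorem sum_Icc_eq_sum_fin (n : ℕ) (f : ℕ → ℝ) :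
    ∑ k ∈ Finset.Icc 1 n, f k = ∑ i : Fin n, f (i + 1) := by
  rw [Fin.sum_univ_eq_sum_range (fun i => f (i + 1)) n, Finset.range_eq_Ico,
    Finset.sum_Ico_add' f 0 n 1]
  rfl

theorem suffixSum_arr {n : ℕ} (v : Fin n → ℝ) (m : ℕ) :
    suffixSum n (arr v) (m + 1) = ∑ i, v i - ∑ i with i.val < m, v i := by
  have h : suffixSum n (arr v) (m + 1) = ∑ i with ¬ i.val < m, v i := by
    rw [suffixSum, Finset.sum_filter]
    have : Finset.Icc (m + 1) n = (Finset.Icc 1 n).filter fun k => ¬ k < m + 1 := by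
      ext k
      simp only [Finset.mem_filter, Finset.mem_Icc]
      omega
    rw [this, Finset.sum_filter, sum_Icc_eq_sum_fin]
    refine Finset.sum_congr rfl fun i _ => ?_
    rw [arr_succ]
    simp
  rw [h, ← Finset.sum_filter_add_sum_filter_not Finset.univ (fun i : Fin n => i.val < m) v]
  ring

theorem arr_nonneg {n : ℕ} {v : Fin n → ℝ} (h : ∀ i, 0 ≤ v i) (i : ℕ) : 0 ≤ arr v i := by
  unfold arr
  split_ifs
  · exact h _
  · exact le_rfl

/-- Subtracting prefix sums from the common total `1` turns the `min` in `glb` into a `max` of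
suffix sums. -/
theorem isInput_arr {n : ℕ} {p q : Fin n → ℝ} (hp : p ∈ orderedProb n) (hq : q ∈ orderedProb n) :
    IsInput n (arr p) (arr q) (arr (glb p q)) := by
  have hz := (glb_spec hp hq).1
  have hsuf : ∀ m, m ≤ n → max (suffixSum n (arr p) (m + 1)) (suffixSum n (arr q) (m + 1))
      = suffixSum n (arr (glb p q)) (m + 1) := by
    intro m hm
    rw [suffixSum_arr, suffixSum_arr, suffixSum_arr, sum_glb p q m hm, hp.2.2, hq.2.2, hz.2.2,
      max_sub_sub_left]
  refine ⟨arr_nonneg hp.2.1, arr_nonneg hq.2.1, ?_, ?_, ?_⟩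
  · rw [suffixSum_arr p 0, suffixSum_arr q 0, hp.2.2, hq.2.2]
    simp
  · intro i j hi hij hj
    rw [arr, arr, dif_pos ⟨by omega, hj⟩, dif_pos ⟨hi, by omega⟩]
    exact hz.1 (by simp only [Fin.le_def]; omega)
  · intro i hi1 hi2
    obtain ⟨m, rfl⟩ : ∃ m, i = m + 1 := ⟨i - 1, by omega⟩
    rw [hsuf m (by omega), hsuf (m + 1) hi2, suffixSum_eq_add _ hi2]
    ring

theorem mainMatrix_mem_couplings {n : ℕ} {p q : Fin n → ℝ} (hp : p ∈ orderedProb n)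
    (hq : q ∈ orderedProb n) (hswap : ¬ NeedsSwap p q) : mainMatrix p q ∈ couplings p q := by
  have hn : 1 ≤ n := by
    rcases n with _ | n
    · simpa using hp.2.2
    · omega
  have hlast : arr q n ≤ arr p n := by
    by_contra hcon
    rw [arr, arr, dif_pos ⟨hn, le_rfl⟩, dif_pos ⟨hn, le_rfl⟩, not_le] at hcon
    -- The absence of a swap is needed only at the last index, where the condition on later indices
    -- is vacuous.
    refine hswap ⟨⟨n - 1, by omega⟩, hcon, fun j hj => ?_⟩
    have := j.2
    simp only [Fin.lt_def] at hj
    omega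
  have h := isCouplingArray_run hn (isInput_arr hp hq) hlast
  refine ⟨fun i j => h.nonneg _ _, fun i => ?_, fun j => ?_⟩
  · rw [← arr_succ p i, ← h.row (i + 1) (by omega) (by omega), sum_Icc_eq_sum_fin]
    rfl
  · rw [← arr_succ q j, ← h.col (j + 1) (by omega) (by omega), sum_Icc_eq_sum_fin]
    rfl

theorem NeedsSwap.not_symm {n : ℕ} {p q : Fin n → ℝ} (h : NeedsSwap p q) : ¬ NeedsSwap q p := by
  rintro ⟨j, hj, hj'⟩
  obtain ⟨i, hi, hi'⟩ := h
  rcases lt_trichotomy i j with hij | rfl | hij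
  · exact hj.ne (hi' j hij).symm
  · exact lt_asymm hi hj
  · exact hi.ne (hj' i hij).symm

end

end MinEntropyCoupling

theorem theorem1 (n : ℕ) (p q : Fin n → ℝ)
    (hp : p ∈ MinEntropyCoupling.orderedProb n) (hq : q ∈ MinEntropyCoupling.orderedProb n) :
    MinEntropyCoupling.minEntropyJointDistribution p q ∈ MinEntropyCoupling.couplings p q := by
  unfold MinEntropyCoupling.minEntropyJointDistribution
  split_ifs with hswap
  · obtain ⟨h1, h2, h3⟩ := MinEntropyCoupling.mainMatrix_mem_couplings hq hp hswap.not_symm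
    exact ⟨fun i j => h1 j i, h3, h2⟩
  · exact MinEntropyCoupling.mainMatrix_mem_couplings hp hq hswap
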